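/- Let $\gamma>0$ and $\tau<0$, and put $\rho=\gamma\tau$. Let $F$ be a distribution function on $\mathbb{R}$, $\overline F=1-F$, belonging to the class $\mathcal F(\gamma,\tau)$: that is, $x^{1/\gamma}\overline F(x)\to C\in(0,\infty)$ as $x\to\infty$, and the function $\delta$ defined by $\overline F(x)=Cx^{-1/\gamma}\{1+\gamma^{-1}\delta(x)\}$ is eventually nonzero and of constant sign, with $|\delta|$ regularly varying at infinity with index $\tau$. Let $U(y)=\inf\{x\in\mathbb{R}: F(x)\ge 1-1/y\}$ for $y>1$, and define $a$ by $U(y)=C^\gamma y^\gamma\{1+a(y)\}$. Let $X_1,X_2,\ldots$ be independent random variables with common distribution function $F$, and let $X_{1:n}\le\cdots\le X_{n:n}$ be the order statistics of $X_1,\ldots,X_n$. Let $k=k_n\in\{1,\ldots,n-1\}$ be integers with $k\to\infty$, $k/n\to0$ and $\sqrt k\,a(n/k)\to\lambda\in\mathbb{R}$ as $n\to\infty$. Let $x_n\to\infty$ be real numbers such that $p_n=\overline F(x_n)$ satisfies $np_n/k\to q$ for some $0<q<1$. Let $\hat\gamma_n,\hat\delta_n,\hat\tau_n$ be arbitrary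 sequences of estimators (random variables), put $\delta_n=\delta(X_{n-k:n})$ and $$\Gamma_{k,n}=\sqrt k(\hat\gamma_n-\gamma),\qquad \Delta_{k,n}=\sqrt k(\hat\delta_n-\delta_n),\qquad Z_{k,n}=\sqrt k\{n\overline F(X_{n-k:n})/k-1\},$$ and suppose that, as $n\to\infty$, $\hat\tau_n\to\tau$ in probability and $(\Gamma_{k,n},\Delta_{k,n},Z_{k,n})\rightsquigarrow(\Gamma,\Delta,Z)$ (convergence in distribution) for some trivariate random vector $(\Gamma,\Delta,Z)$. Define the tail probability estimator $$\hat p_{k,n}=\frac kn\,\overline G_{\hat\gamma_n,\hat\delta_n,\hat\tau_n}(x_n/X_{n-k:n}),$$ where $\overline G_{\gamma,\delta,\tau}(y)=\{y(1+\delta-\delta y^\tau)\}^{-1/\gamma}$ for $y>1$ and $\overline G_{\gamma,\delta,\tau}(y)=1$ for $y\le1$ is the tail function of the extended Pareto distribution. Then $$\sqrt k\left(\frac{\hat p_{k,n}}{p_n}-1\right)\rightsquigarrow-\gamma^{-1}\Gamma\log q-\gamma^{-1}\Delta(1-q^{-\rho})-Z,\qquad n\to\infty.$$ -/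

import Mathlib

open MeasureTheory ProbabilityTheory Filter Topology

noncomputable section

namespace ExtPareto

/-- Tail function `1 - F` of a distribution function `F`. -/
def tail (F : ℝ → ℝ) (x : ℝ) : ℝ := 1 - F x

/-- Distribution function of the extended Pareto distribution with parameters `(γ, δ, τ)`. -/
def epdCDF (γ δ τ y : ℝ) : ℝ :=
  if 1 < y then 1 - (y * (1 + δ - δ * y ^ τ)) ^ (-1 / γ) else 0

/-- `f` is positive and measurable on some right neighbourhood of infinity and regularly varying
there with index `β`. -/
structure IsRegularlyVarying (f : ℝ → ℝ) (β : ℝ) : Prop where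
  pos_measurable : ∃ x₀ : ℝ, (∀ x, x₀ < x → 0 < f x) ∧ Measurable (fun x : Set.Ioi x₀ => f x)
  tendsto_ratio : ∀ x : ℝ, 0 < x → Tendsto (fun u => f (u * x) / f u) atTop (𝓝 (x ^ β))

/-- The function `δ` with `1 - F x = C * x ^ (-1/γ) * (1 + γ⁻¹ * δ x)` for `x > 0`
(see `tail_eq`). -/
def delta (F : ℝ → ℝ) (γ C x : ℝ) : ℝ := γ * (x ^ (1 / γ) * tail F x / C - 1)

theorem tail_eq (F : ℝ → ℝ) {γ C x : ℝ} (hγ : 0 < γ) (hC : 0 < C) (hx : 0 < x) :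
    tail F x = C * x ^ (-1 / γ) * (1 + γ⁻¹ * delta F γ C x) := by
  have h : x ^ (-1 / γ) * x ^ (1 / γ) = 1 := by
    rw [← Real.rpow_add hx, neg_div, neg_add_cancel, Real.rpow_zero]
  have h2 : 1 + γ⁻¹ * delta F γ C x = x ^ (1 / γ) * tail F x / C := by
    unfold delta
    field_simp
    ring
  rw [h2]
  calc tail F x = (x ^ (-1 / γ) * x ^ (1 / γ)) * tail F x := by rw [h, one_mul]
    _ = _ := by field_simp

/-- `F` belongs to the class `𝓕(γ, τ)`, with `C` the limit of `x ^ (1/γ) * (1 - F x)`. -/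
structure InClass (F : ℝ → ℝ) (γ τ C : ℝ) : Prop where
  pos : 0 < C
  tendsto_tail : Tendsto (fun x => x ^ (1 / γ) * tail F x) atTop (𝓝 C)
  const_sign : (∀ᶠ x in atTop, 0 < delta F γ C x) ∨ (∀ᶠ x in atTop, delta F γ C x < 0)
  regVar : IsRegularlyVarying (fun x => |delta F γ C x|) τ

/-- Quantile function `Q p = inf {x | F x ≥ p}`, for `0 < p < 1`. -/
def quantile (F : ℝ → ℝ) (p : ℝ) : ℝ := sInf {x : ℝ | p ≤ F x}

/-- Tail quantile function `U y = Q (1 - 1/y)`, for `y > 1`. -/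
def tailQuantile (F : ℝ → ℝ) (y : ℝ) : ℝ := quantile F (1 - 1 / y)

/-- The function `a` with `U y = C ^ γ * y ^ γ * (1 + a y)` (see `tailQuantile_eq`). -/
def auxA (F : ℝ → ℝ) (γ C y : ℝ) : ℝ := tailQuantile F y / (C ^ γ * y ^ γ) - 1

theorem tailQuantile_eq (F : ℝ → ℝ) (γ : ℝ) {C y : ℝ} (hC : 0 < C) (hy : 0 < y) :
    tailQuantile F y = C ^ γ * y ^ γ * (1 + auxA F γ C y) := by
  have h1 : C ^ γ ≠ 0 := (Real.rpow_pos_of_pos hC γ).ne'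
  have h2 : y ^ γ ≠ 0 := (Real.rpow_pos_of_pos hy γ).ne'
  unfold auxA
  field_simp
  ring

/-- `k` is an intermediate sequence: `k n ∈ {1, …, n-1}`, `k n → ∞` and `k n / n → 0`. -/
structure IsIntermediate (k : ℕ → ℕ) : Prop where
  mem : ∀ n, 2 ≤ n → 1 ≤ k n ∧ k n ≤ n - 1
  tendsto_atTop : Tendsto k atTop atTop
  tendsto_div : Tendsto (fun n => (k n : ℝ) / n) atTop (𝓝 0)

/-- The `j`-th smallest order statistic `X_{j:n}`, `1 ≤ j ≤ n`, of the sample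
`X 0, …, X (n-1)`; it is set to `0` for `j` out of range. -/
def orderStat {Ω : Type*} (X : ℕ → Ω → ℝ) (n j : ℕ) (ω : Ω) : ℝ :=
  if h : 1 ≤ j ∧ j ≤ n then
    X (Tuple.sort (fun i : Fin n => X i ω) ⟨j - 1, by omega⟩) ω
  else 0

/-- `Z_{k,n} = √k (n (1 - F (X_{n-k:n})) / k - 1)`. -/
def Zstat {Ω : Type*} (F : ℝ → ℝ) (X : ℕ → Ω → ℝ) (k : ℕ → ℕ) (n : ℕ) (ω : Ω) : ℝ :=
  √(k n : ℝ) * (n * tail F (orderStat X n (n - k n) ω) / k n - 1)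

/-- Tail probability estimator
`(k / n) * (1 - G_{γ̂, δ̂, τ̂} (x_n / X_{n-k:n}))`, with `G` the extended Pareto
distribution function. -/
def pHat {Ω : Type*} (X : ℕ → Ω → ℝ) (k : ℕ → ℕ) (γhat δhat τhat : ℕ → Ω → ℝ) (x : ℕ → ℝ)
    (n : ℕ) (ω : Ω) : ℝ :=
  (k n : ℝ) / n *
    tail (epdCDF (γhat n ω) (δhat n ω) (τhat n ω)) (x n / orderStat X n (n - k n) ω)

end ExtPareto

end

/-! Write s = √k, y = n/k, Y = X_{n-k:n}. The tail expansion turns log(p̂/p) into an exact sum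
(`log_estimator_ratio`): -log(y·tail(Y)), a term in γ⁻¹ - γ̂⁻¹, the extended Pareto correction, and
the second-order terms at Y and x. Since x/Y → q^(-γ), regular variation gives δ(x) ~ q^(-ρ) δ(Y).
If s·δ(Y) → m, the correction contributes -γ⁻¹m(1 - q^(-ρ)) and the second-order terms contribute
the opposite, so m cancels and its value is irrelevant.

It remains to keep s·δ(Y) bounded. This is where √k·a(n/k) → λ enters:
`InClass.abs_delta_tailQuantile_le` bounds δ at the quantile U(y) through a(y), and the uniform
convergence theorem carries the bound to Y, because Y/U(y) → 1.

Randomness is removed by `tendstoInMeasure_zero_of_ultrafilter`: tightness and compactness allow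
arguing along ultrafilters on ℕ × Ω where all statistics converge, so
`InClass.tendsto_relative_error` is purely deterministic. Continuous mapping and Slutsky conclude.
-/

namespace ExtPareto

/-! ### Uniform convergence for regularly varying functions -/

/-- **Uniform convergence theorem**, additive form at the origin. -/
theorem tendsto_add_sub_prod_nhds_zero {h : ℝ → ℝ} (hm : Measurable h)
    (hh : ∀ u, Tendsto (fun s => h (s + u) - h s) atTop (𝓝 0)) :
    Tendsto (fun z : ℝ × ℝ => h (z.1 + z.2) - h z.1) (atTop ×ˢ 𝓝 0) (𝓝 0) := by
  -- Truncating at 1 makes dominated convergence available without local integrability of `h`;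
  -- nothing is lost for increments below 1.
  set G : ℝ → ℝ → ℝ := fun s w => min 1 |h (s + w) - h s| with hG
  have hG0 : ∀ s w, 0 ≤ G s w := fun s w => le_min zero_le_one (abs_nonneg _)
  have hG1 : ∀ s w, G s w ≤ 1 := fun s w => min_le_left _ _
  have hGm : ∀ s, Measurable (G s) := fun s => by
    simp only [hG]
    fun_prop
  have hGi : ∀ s a b, IntervalIntegrable (G s) volume a b := fun s a b => by
    refine (intervalIntegrable_const (c := (1 : ℝ))).mono_fun (hGm s).aestronglyMeasurable ?_
    refine ae_of_all _ fun w => ?_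
    simpa [abs_of_nonneg (hG0 s w)] using hG1 s w
  set I : ℝ → ℝ := fun s => ∫ w in (0 : ℝ)..3, G s w with hI
  have hI0 : Tendsto I atTop (𝓝 0) := by
    have : Tendsto I atTop (𝓝 (∫ w in (0 : ℝ)..3, (0 : ℝ))) := by
      refine intervalIntegral.tendsto_integral_filter_of_dominated_convergence (fun _ => 1)
        (Eventually.of_forall fun s => (hGm s).aestronglyMeasurable) ?_
        intervalIntegrable_const ?_
      · refine Eventually.of_forall fun s => ae_of_all _ fun w _ => ?_
        simpa [abs_of_nonneg (hG0 s w)] using hG1 s w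
      · refine ae_of_all _ fun w _ => ?_
        have := (hh w).abs
        simpa using (tendsto_const_nhds (x := (1 : ℝ))).min this
    simpa using this
  -- Compare both endpoints with an intermediate point s + w and average over w ∈ [1, 2]. For |v| ≤
  -- 1 the shifted variable w - v stays in [0, 3], the range of `I`.
  have key : ∀ s v, |v| ≤ 1 → G s v ≤ I s + I (s + v) := by
    intro s v hv
    obtain ⟨hv1, hv2⟩ := abs_le.1 hv
    have pt : ∀ w, G s v ≤ G s w + G (s + v) (w - v) := by
      intro w
      have e : s + v + (w - v) = s + w := by ring
      have := abs_sub_le (h (s + v)) (h (s + w)) (h s)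
      rw [abs_sub_comm (h (s + v)) (h (s + w))] at this
      simp only [hG, e]
      rcases le_total 1 |h (s + w) - h s| with h1 | h1
      · rw [min_eq_left h1]
        have := hG0 (s + v) (w - v)
        simp only [hG, e] at this
        linarith [min_le_left 1 |h (s + v) - h s|]
      · rcases le_total 1 |h (s + w) - h (s + v)| with h2 | h2
        · rw [min_eq_left h2]
          linarith [min_le_left 1 |h (s + v) - h s|, hG0 s w]
        · rw [min_eq_right h1, min_eq_right h2]
          linarith [min_le_right 1 |h (s + v) - h s|]
    have i2 : IntervalIntegrable (fun w => G (s + v) (w - v)) volume 1 2 := by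
      have := (hGi (s + v) (1 - v) (2 - v)).comp_sub_right v
      simpa using this
    calc G s v = ∫ _ in (1 : ℝ)..2, G s v := by
          rw [intervalIntegral.integral_const, smul_eq_mul]
          ring
      _ ≤ ∫ w in (1 : ℝ)..2, (G s w + G (s + v) (w - v)) :=
          intervalIntegral.integral_mono_on (by norm_num) intervalIntegrable_const
            ((hGi s 1 2).add i2) fun w _ => pt w
      _ = (∫ w in (1 : ℝ)..2, G s w) + ∫ w in (1 - v)..(2 - v), G (s + v) w := by
          rw [intervalIntegral.integral_add (hGi s 1 2) i2,
            intervalIntegral.integral_comp_sub_right (fun w => G (s + v) w) v]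
      _ ≤ I s + I (s + v) := by
          refine add_le_add ?_ ?_
          · exact intervalIntegral.integral_mono_interval (by norm_num) (by norm_num)
              (by norm_num) (ae_of_all _ (hG0 s)) (hGi s 0 3)
          · exact intervalIntegral.integral_mono_interval (by linarith) (by linarith)
              (by linarith) (ae_of_all _ (hG0 (s + v))) (hGi (s + v) 0 3)
  have hlim : Tendsto (fun z : ℝ × ℝ => I z.1 + I (z.1 + z.2)) (atTop ×ˢ 𝓝 0) (𝓝 0) := by
    have h1 := hI0.comp (tendsto_fst (f := (atTop : Filter ℝ)) (g := 𝓝 (0 : ℝ)))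
    have h2 := hI0.comp ((tendsto_fst (f := (atTop : Filter ℝ)) (g := 𝓝 (0 : ℝ))).atTop_add
      (tendsto_snd (f := (atTop : Filter ℝ)) (g := 𝓝 (0 : ℝ))))
    simpa using h1.add h2
  rw [Metric.tendsto_nhds]
  intro ε hε
  have hsnd : ∀ᶠ z : ℝ × ℝ in atTop ×ˢ 𝓝 0, |z.2| ≤ 1 := by
    have := (tendsto_snd (f := (atTop : Filter ℝ)) (g := 𝓝 (0 : ℝ))).eventually
      (Metric.closedBall_mem_nhds (0 : ℝ) one_pos)
    filter_upwards [this] with z hz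
    simpa using hz
  filter_upwards [hsnd, hlim.eventually (gt_mem_nhds (lt_min one_pos hε))] with z h1 h2
  have h3 := (key z.1 z.2 h1).trans_lt h2
  rw [lt_min_iff] at h3
  rw [Real.dist_eq, sub_zero]
  rcases min_lt_iff.1 h3.1 with h4 | h4
  · exact absurd h4 (lt_irrefl _)
  · have h5 := h3.2
    simp only [hG] at h5
    rwa [min_eq_right h4.le] at h5

/-- **Uniform convergence theorem** for regularly varying functions, in local form. -/
theorem tendsto_ratio_prod_nhds {f : ℝ → ℝ} {β : ℝ} (hm : Measurable f)
    (hpos : ∀ᶠ x in atTop, 0 < f x)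
    (hf : ∀ x : ℝ, 0 < x → Tendsto (fun u => f (u * x) / f u) atTop (𝓝 (x ^ β)))
    {t : ℝ} (ht : 0 < t) :
    Tendsto (fun z : ℝ × ℝ => f (z.1 * z.2) / f z.1) (atTop ×ˢ 𝓝 t) (𝓝 (t ^ β)) := by
  set h : ℝ → ℝ := fun s => Real.log (f (Real.exp s)) - β * s with hh
  have hmeas : Measurable h := by
    simp only [hh]
    fun_prop
  have hlim : ∀ u, Tendsto (fun s => h (s + u) - h s) atTop (𝓝 0) := by
    intro u
    have h1 := (hf (Real.exp u) (Real.exp_pos u)).comp Real.tendsto_exp_atTop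
    have h2 := h1.log (Real.rpow_pos_of_pos (Real.exp_pos u) β).ne'
    rw [Real.log_rpow (Real.exp_pos u), Real.log_exp] at h2
    have h3 := h2.sub_const (β * u)
    rw [sub_self] at h3
    refine h3.congr' ?_
    have e1 := Real.tendsto_exp_atTop.eventually hpos
    have e2 := (tendsto_atTop_add_const_right atTop u tendsto_id).eventually e1
    filter_upwards [e1, e2] with s p1 p2
    simp only [id] at p2
    simp only [hh, Function.comp]
    rw [← Real.exp_add, Real.log_div p2.ne' p1.ne']
    ring
  have hloc := tendsto_add_sub_prod_nhds_zero hmeas hlim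
  have hfst := tendsto_fst (f := (atTop : Filter ℝ)) (g := 𝓝 t)
  have hsnd := tendsto_snd (f := (atTop : Filter ℝ)) (g := 𝓝 t)
  have hlogt : Tendsto (fun z : ℝ × ℝ => Real.log z.2 - Real.log t) (atTop ×ˢ 𝓝 t) (𝓝 0) := by
    simpa using (hsnd.log ht.ne').sub_const (Real.log t)
  have hlogs : Tendsto (fun z : ℝ × ℝ => Real.log z.1 + Real.log t) (atTop ×ˢ 𝓝 t) atTop :=
    tendsto_atTop_add_const_right _ _ (Real.tendsto_log_atTop.comp hfst)
  -- In logarithms, the passage from z.1 to z.1 * z.2 is the fixed shift log t (pointwise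
  -- hypothesis) followed by the vanishing shift log z.2 - log t (local uniformity).
  have h1 := hloc.comp (hlogs.prodMk hlogt)
  have h2 := (hlim (Real.log t)).comp (Real.tendsto_log_atTop.comp hfst)
  have h3 := (h1.add h2).add ((hsnd.log ht.ne').const_mul β)
  have h4 := (Real.continuous_exp.tendsto _).comp h3
  have e0 : Real.exp (0 + 0 + β * Real.log t) = t ^ β := by
    rw [Real.rpow_def_of_pos ht]
    ring_nf
  rw [e0] at h4
  refine h4.congr' ?_
  have p1 := hfst.eventually (hpos.and (eventually_gt_atTop 0))
  have p2 := (hfst.atTop_mul_pos ht hsnd).eventually hpos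
  have p3 := hsnd.eventually (lt_mem_nhds ht)
  filter_upwards [p1, p2, p3] with z q1 q2 q3
  have l1 : Real.log z.1 + Real.log t + (Real.log z.2 - Real.log t)
      = Real.log (z.1 * z.2) := by
    rw [Real.log_mul q1.2.ne' q3.ne']
    ring
  simp only [Function.comp, l1, hh]
  rw [Real.exp_log (mul_pos q1.2 q3), Real.exp_log q1.2]
  rw [show Real.log (f (z.1 * z.2)) - β * Real.log (z.1 * z.2)
        - (Real.log (f (Real.exp (Real.log z.1 + Real.log t)))
          - β * (Real.log z.1 + Real.log t))
        + (Real.log (f (Real.exp (Real.log z.1 + Real.log t)))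
          - β * (Real.log z.1 + Real.log t) - (Real.log (f z.1) - β * Real.log z.1))
        + β * Real.log z.2 = Real.log (f (z.1 * z.2)) - Real.log (f z.1) by
      rw [Real.log_mul q1.2.ne' q3.ne']; ring]
  rw [← Real.log_div q2.ne' q1.1.ne', Real.exp_log (div_pos q2 q1.1)]

theorem measurable_delta {F : ℝ → ℝ} (hF : Monotone F) (γ C : ℝ) :
    Measurable (delta F γ C) := by
  have := hF.measurable
  unfold delta tail
  fun_prop

theorem InClass.tendsto_delta_ratio {F : ℝ → ℝ} {γ τ C : ℝ} (hF : InClass F γ τ C)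
    (hmono : Monotone F) {t : ℝ} (ht : 0 < t) :
    Tendsto (fun z : ℝ × ℝ => delta F γ C (z.1 * z.2) / delta F γ C z.1) (atTop ×ˢ 𝓝 t)
      (𝓝 (t ^ τ)) := by
  have hne : ∀ᶠ x in atTop, 0 < |delta F γ C x| := by
    rcases hF.const_sign with h | h <;> filter_upwards [h] with x hx
    · exact abs_pos.2 hx.ne'
    · exact abs_pos.2 hx.ne
  have h1 := tendsto_ratio_prod_nhds (measurable_delta hmono γ C).abs hne
    hF.regVar.tendsto_ratio ht
  refine h1.congr' ?_
  have hfst := tendsto_fst (f := (atTop : Filter ℝ)) (g := 𝓝 t)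
  have hsnd := tendsto_snd (f := (atTop : Filter ℝ)) (g := 𝓝 t)
  have hmul := hfst.atTop_mul_pos ht hsnd
  rcases hF.const_sign with h | h <;> filter_upwards [hfst.eventually h, hmul.eventually h]
    with z h1 h2
  · rw [abs_of_pos h1, abs_of_pos h2]
  · rw [abs_of_neg h1, abs_of_neg h2, neg_div_neg_eq]

/-! ### Delta method along a filter -/

section Calculus

variable {ι : Type*} {l : Filter ι}

theorem tendsto_zero_of_mul_tendsto {s v : ι → ℝ} {c : ℝ} (hs : Tendsto s l atTop)
    (hv : Tendsto (fun i => s i * v i) l (𝓝 c)) : Tendsto v l (𝓝 0) := by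
  refine (hv.div_atTop hs).congr' ?_
  filter_upwards [hs.eventually_gt_atTop 0] with i hi
  field_simp

/-- Delta method for deterministic sequences. -/
theorem tendsto_mul_sub_of_hasDerivAt {s v : ι → ℝ} {c a f' : ℝ} {f : ℝ → ℝ}
    (hf : HasDerivAt f f' a) (hs : Tendsto s l atTop)
    (hv : Tendsto (fun i => s i * v i) l (𝓝 c)) :
    Tendsto (fun i => s i * (f (a + v i) - f a)) l (𝓝 (c * f')) := by
  have hv0 := tendsto_zero_of_mul_tendsto hs hv
  have hav : Tendsto (fun i => a + v i) l (𝓝 a) := by simpa using hv0.const_add a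
  have hc := (continuousAt_dslope_same.2 hf.differentiableAt).tendsto.comp hav
  rw [dslope_same, hf.deriv] at hc
  refine (hv.mul hc).congr fun i => ?_
  have := sub_smul_dslope f a (a + v i)
  simp only [add_sub_cancel_left, smul_eq_mul] at this
  simp only [Function.comp, mul_assoc, this]

theorem tendsto_mul_log_one_add {s v : ι → ℝ} {c : ℝ} (hs : Tendsto s l atTop)
    (hv : Tendsto (fun i => s i * v i) l (𝓝 c)) :
    Tendsto (fun i => s i * Real.log (1 + v i)) l (𝓝 c) := by
  simpa using tendsto_mul_sub_of_hasDerivAt (Real.hasDerivAt_log one_ne_zero) hs hv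

end Calculus

/-! ### First-order location of points from their tail -/

section Location

variable {ι : Type*} {l : Filter ι} {F : ℝ → ℝ} {γ τ C : ℝ}

theorem InClass.eventually_tail_pos (hF : InClass F γ τ C) : ∀ᶠ x in atTop, 0 < tail F x := by
  filter_upwards [hF.tendsto_tail.eventually (lt_mem_nhds hF.pos), eventually_gt_atTop 0]
    with x h1 h2
  exact pos_of_mul_pos_right h1 (Real.rpow_nonneg h2.le _)

theorem InClass.tendsto_atTop_of_tail (hF : InClass F γ τ C) (hmono : Monotone F) {t : ι → ℝ}
    (h : Tendsto (fun i => tail F (t i)) l (𝓝 0)) : Tendsto t l atTop := by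
  rw [tendsto_atTop]
  intro b
  -- The tail never vanishes far out, so a tail below that of M forces the point beyond M.
  obtain ⟨M, hM, hb⟩ := (hF.eventually_tail_pos.and (eventually_ge_atTop b)).exists
  filter_upwards [h.eventually (gt_mem_nhds hM)] with i hi
  by_contra! hlt
  have := hmono (hlt.le.trans hb)
  unfold tail at hi
  linarith

theorem InClass.tendsto_delta (hF : InClass F γ τ C) : Tendsto (delta F γ C) atTop (𝓝 0) := by
  have h := ((hF.tendsto_tail.div_const C).sub_const 1).const_mul γ
  rwa [div_self hF.pos.ne', sub_self, mul_zero] at h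

/-- Divide t^(1/γ)·tail(t) → C by y·tail(t) → c and raise to the power γ. It locates x, Y and U(y)
on the common scale y^γ. -/
theorem InClass.tendsto_div_rpow (hF : InClass F γ τ C) (hγ : 0 < γ) {t y : ι → ℝ} {c : ℝ}
    (hc : 0 < c) (ht : Tendsto t l atTop) (hy : Tendsto y l atTop)
    (h : Tendsto (fun i => y i * tail F (t i)) l (𝓝 c)) :
    Tendsto (fun i => t i / y i ^ γ) l (𝓝 ((C / c) ^ γ)) := by
  have h1 := ((hF.tendsto_tail.comp ht).div h hc.ne').rpow_const (p := γ) (Or.inr hγ.le)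
  refine h1.congr' ?_
  filter_upwards [ht.eventually_gt_atTop 0, hy.eventually_gt_atTop 0,
    ht.eventually hF.eventually_tail_pos] with i p1 p2 p3
  simp only [Function.comp, Pi.div_apply]
  rw [mul_div_mul_right _ _ p3.ne', Real.div_rpow (Real.rpow_nonneg p1.le _) p2.le,
    ← Real.rpow_mul p1.le, one_div, inv_mul_cancel₀ hγ.ne', Real.rpow_one]

end Location

/-! ### Quantiles and the link between δ and a -/

section Quantile

variable (μ : Measure ℝ) {p : ℝ}

theorem cdf_lt_of_lt_quantile (hp : 0 < p) {v : ℝ} (hv : v < quantile (cdf μ) p) :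
    cdf μ v < p := by
  by_contra! h
  refine absurd (csInf_le (s := {x : ℝ | p ≤ cdf μ x}) ?_ h) (not_le.2 hv)
  obtain ⟨b, hb⟩ := ((tendsto_cdf_atBot μ).eventually (gt_mem_nhds hp)).exists
  refine ⟨b, fun z hz => ?_⟩
  by_contra! hlt
  exact absurd (le_trans hz (monotone_cdf μ hlt.le)) (not_le.2 hb)

theorem le_cdf_quantile (hp : p < 1) : p ≤ cdf μ (quantile (cdf μ) p) := by
  have hne : {x : ℝ | p ≤ cdf μ x}.Nonempty := by
    obtain ⟨b, hb⟩ := ((tendsto_cdf_atTop μ).eventually (lt_mem_nhds hp)).exists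
    exact ⟨b, hb.le⟩
  have hr : Tendsto (cdf μ) (𝓝[>] (quantile (cdf μ) p)) (𝓝 (cdf μ (quantile (cdf μ) p))) :=
    ((cdf μ).right_continuous _).mono_left (nhdsWithin_mono _ Set.Ioi_subset_Ici_self)
  refine ge_of_tendsto hr ?_
  filter_upwards [self_mem_nhdsWithin] with v hv
  obtain ⟨z, hz, hzv⟩ := exists_lt_of_csInf_lt hne hv
  exact le_trans hz (monotone_cdf μ hzv.le)

variable {μ} {γ τ C : ℝ}

theorem InClass.tendsto_tailQuantile (hF : InClass (cdf μ) γ τ C) :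
    Tendsto (tailQuantile (cdf μ)) atTop atTop := by
  refine hF.tendsto_atTop_of_tail (monotone_cdf μ) ?_
  refine squeeze_zero' (g := fun y => y⁻¹) (Eventually.of_forall fun y => ?_) ?_
    tendsto_inv_atTop_zero
  · exact sub_nonneg.2 (cdf_le_one μ _)
  · filter_upwards [eventually_gt_atTop 0] with y hy
    have := le_cdf_quantile μ (p := 1 - 1 / y) (by linarith [one_div_pos.2 hy])
    unfold tail tailQuantile
    rw [← one_div]
    linarith

/-- The second-order term of the tail at a quantile is controlled by that of the quantile
function. -/
theorem InClass.abs_delta_tailQuantile_le (hF : InClass (cdf μ) γ τ C) (hγ : 0 < γ) :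
    ∀ᶠ y in atTop, |delta (cdf μ) γ C (tailQuantile (cdf μ) y)|
      ≤ 2 * γ * |(1 + auxA (cdf μ) γ C y) ^ (1 / γ) - 1| := by
  have hC := hF.pos
  have hU := hF.tendsto_tailQuantile
  have hratio := (hF.tendsto_delta_ratio (monotone_cdf μ) one_pos)
  rw [Real.one_rpow] at hratio
  obtain ⟨pa, hpa, pb, hpb, hab⟩ := eventually_prod_iff.1
    (hratio.eventually (lt_mem_nhds (show (1 / 2 : ℝ) < 1 by norm_num)))
  -- The neighbourhood `pb` of 1 does not depend on y; this uniformity permits letting η ↑ 1 at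
  -- fixed y below.
  filter_upwards [hU.eventually hpa, hU.eventually_gt_atTop 0, eventually_gt_atTop 1]
    with y hy1 hU0 hy
  set U := tailQuantile (cdf μ) y with hUdef
  set d := delta (cdf μ) γ C with hd
  set A := (1 + auxA (cdf μ) γ C y) ^ (1 / γ) with hA
  have hy0 : 0 < y := by linarith
  have hUA : U ^ (1 / γ) = C * y * A := by
    have ha : 0 ≤ 1 + auxA (cdf μ) γ C y := by
      have e := tailQuantile_eq (cdf μ) γ hC hy0
      rw [← hUdef] at e
      rw [e] at hU0
      exact (pos_of_mul_pos_right hU0 (by positivity)).le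
    rw [hUdef, tailQuantile_eq (cdf μ) γ hC hy0, Real.mul_rpow (by positivity) ha,
      Real.mul_rpow (by positivity) (by positivity), ← Real.rpow_mul hC.le,
      ← Real.rpow_mul hy0.le, mul_one_div_cancel hγ.ne', Real.rpow_one, Real.rpow_one]
  have hdelta : ∀ v, d v = γ * (v ^ (1 / γ) * tail (cdf μ) v / C - 1) := fun v => rfl
  have hA0 : 0 < A := by
    have : 0 < U ^ (1 / γ) := Real.rpow_pos_of_pos hU0 _
    rw [hUA] at this
    exact pos_of_mul_pos_right this (by positivity)
  -- F may jump at U, so only tail(U) ≤ 1/y holds; this yields one side.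
  have hup : d U ≤ γ * (A - 1) := by
    have ht : tail (cdf μ) U ≤ 1 / y := by
      have := le_cdf_quantile μ (p := 1 - 1 / y) (by linarith [one_div_pos.2 hy0])
      unfold tail
      rw [hUdef]
      unfold tailQuantile
      linarith
    rw [hdelta, hUA]
    gcongr
    calc C * y * A * tail (cdf μ) U / C ≤ C * y * A * (1 / y) / C := by gcongr
      _ = A := by field_simp
  rcases le_or_gt 0 (d U) with h0 | h0
  · rw [abs_of_nonneg h0]
    have : A - 1 ≤ |A - 1| := le_abs_self _
    nlinarith [abs_nonneg (A - 1)]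
  -- Left of U the tail exceeds 1/y, which bounds δ(Uη) below. As δ(U) < 0, the ratio bound
  -- δ(Uη)/δ(U) > 1/2 gives δ(U) > 2δ(Uη); then η ↑ 1.
  have hlow : 2 * (γ * (A - 1)) ≤ d U := by
    have hlim : Tendsto (fun η : ℝ => 2 * (γ * (η ^ (1 / γ) * A - 1))) (𝓝[<] 1)
        (𝓝 (2 * (γ * ((1 : ℝ) ^ (1 / γ) * A - 1)))) := by
      have : Tendsto (fun η : ℝ => η ^ (1 / γ)) (𝓝[<] 1) (𝓝 ((1 : ℝ) ^ (1 / γ))) :=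
        ((Real.continuousAt_rpow_const 1 (1 / γ) (Or.inl one_ne_zero)).tendsto).mono_left
          nhdsWithin_le_nhds
      exact (((this.mul_const A).sub_const 1).const_mul γ).const_mul 2
    rw [Real.one_rpow, one_mul] at hlim
    refine le_of_tendsto hlim ?_
    have hp1 : ∀ᶠ η in 𝓝[<] (1 : ℝ), pb η := nhdsWithin_le_nhds hpb
    have hp2 : ∀ᶠ η in 𝓝[<] (1 : ℝ), 0 < η := nhdsWithin_le_nhds (lt_mem_nhds one_pos)
    filter_upwards [hp1, hp2, self_mem_nhdsWithin] with η h1 h2 h3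
    have h4 := hab hy1 h1
    simp only at h4
    rw [lt_div_iff_of_neg h0] at h4
    have h5 : cdf μ (U * η) < 1 - 1 / y := by
      refine cdf_lt_of_lt_quantile μ ?_ ?_
      · have : 1 / y < 1 := by rw [div_lt_one hy0]; exact hy
        linarith
      · have : U * η < U := by nlinarith [Set.mem_Iio.1 h3]
        exact this
    have h6 : η ^ (1 / γ) * A ≤ (U * η) ^ (1 / γ) * tail (cdf μ) (U * η) / C := by
      rw [Real.mul_rpow hU0.le h2.le, hUA]
      have h7 : 1 / y ≤ tail (cdf μ) (U * η) := by
        unfold tail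
        linarith
      calc η ^ (1 / γ) * A = C * y * A * η ^ (1 / γ) * (1 / y) / C := by field_simp
        _ ≤ _ := by gcongr
    have h8 : γ * (η ^ (1 / γ) * A - 1) ≤ d (U * η) := by
      rw [hdelta]
      gcongr
    linarith
  rw [abs_of_neg h0]
  have : -|A - 1| ≤ A - 1 := neg_abs_le _
  nlinarith [abs_nonneg (A - 1)]

end Quantile

/-! ### Deterministic expansion of the relative error -/

section Expansion

variable {ι : Type*} {l : Filter ι} {F : ℝ → ℝ} {γ τ C : ℝ}

theorem InClass.tendsto_mul_delta (hF : InClass F γ τ C) (hmono : Monotone F)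
    {s t t' : ι → ℝ} {c m : ℝ} (hc : 0 < c) (ht : Tendsto t l atTop)
    (hr : Tendsto (fun i => t' i / t i) l (𝓝 c))
    (hm : Tendsto (fun i => s i * delta F γ C (t i)) l (𝓝 m)) :
    Tendsto (fun i => s i * delta F γ C (t' i)) l (𝓝 (m * c ^ τ)) := by
  have h := hm.mul ((hF.tendsto_delta_ratio hmono hc).comp (ht.prodMk hr))
  refine h.congr' ?_
  have hne : ∀ᶠ x in atTop, delta F γ C x ≠ 0 := by
    rcases hF.const_sign with h | h <;> filter_upwards [h] with x hx
    · exact hx.ne'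
    · exact hx.ne
  filter_upwards [ht.eventually hne, ht.eventually_ne_atTop 0] with i h1 h2
  simp only [Function.comp]
  rw [mul_div_cancel₀ _ h2]
  field_simp

theorem tail_epdCDF {γ δ τ y : ℝ} (hy : 1 < y) :
    tail (epdCDF γ δ τ) y = (y * (1 + δ * (1 - y ^ τ))) ^ (-1 / γ) := by
  unfold tail epdCDF
  rw [if_pos hy, sub_sub_cancel]
  ring_nf

theorem log_tail_eq (hγ : 0 < γ) (hC : 0 < C) {x : ℝ} (hx : 0 < x)
    (hd : 0 < 1 + γ⁻¹ * delta F γ C x) :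
    Real.log (tail F x)
      = Real.log C - γ⁻¹ * Real.log x + Real.log (1 + γ⁻¹ * delta F γ C x) := by
  have h1 : 0 < x ^ (-1 / γ) := Real.rpow_pos_of_pos hx _
  rw [tail_eq F hγ hC hx, Real.log_mul (mul_pos hC h1).ne' hd.ne', Real.log_mul hC.ne' h1.ne',
    Real.log_rpow hx]
  ring

/-- The factor C and the leading powers in tail(Y) and tail(x) combine into γ⁻¹ log(x/Y), so every
remaining term is small or estimated at rate s. -/
theorem log_estimator_ratio (hγ : 0 < γ) (hC : 0 < C) {x Y y g d t : ℝ} (hy : 0 < y)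
    (hY : 0 < Y) (hr : 1 < x / Y) (hw : 0 < 1 + d * (1 - (x / Y) ^ t))
    (hdY : 0 < 1 + γ⁻¹ * delta F γ C Y) (hdx : 0 < 1 + γ⁻¹ * delta F γ C x)
    (htY : 0 < tail F Y) (htx : 0 < tail F x) :
    Real.log (y⁻¹ * tail (epdCDF g d t) (x / Y) / tail F x)
      = -Real.log (y * tail F Y) + (γ⁻¹ - g⁻¹) * Real.log (x / Y)
        - g⁻¹ * Real.log (1 + d * (1 - (x / Y) ^ t))
        + Real.log (1 + γ⁻¹ * delta F γ C Y) - Real.log (1 + γ⁻¹ * delta F γ C x) := by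
  have hr0 : 0 < x / Y := by linarith
  have hx : 0 < x := by
    have := mul_pos hr0 hY
    rwa [div_mul_cancel₀ _ hY.ne'] at this
  have hE := Real.rpow_pos_of_pos (mul_pos hr0 hw) (-1 / g)
  rw [tail_epdCDF hr, Real.log_div (mul_pos (inv_pos.2 hy) hE).ne' htx.ne',
    Real.log_mul (inv_pos.2 hy).ne' hE.ne', Real.log_inv, Real.log_rpow (mul_pos hr0 hw),
    Real.log_mul hr0.ne' hw.ne', Real.log_mul hy.ne' htY.ne', log_tail_eq hγ hC hx hdx,
    log_tail_eq hγ hC hY hdY, Real.log_div hx.ne' hY.ne']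
  ring

/-- Expansion of the relative error of the tail probability estimator when the threshold `Y`
and the normalised errors of the parameter estimates converge along a filter. -/
theorem InClass.tendsto_relative_error (hF : InClass F γ τ C) (hγ : 0 < γ) (hmono : Monotone F)
    {s y Y x γh δh τh : ι → ℝ} {q g d z m : ℝ} (hq0 : 0 < q) (hq1 : q < 1)
    (hs : Tendsto s l atTop) (hy : Tendsto y l atTop) (hx : Tendsto x l atTop)
    (hY : Tendsto Y l atTop)
    (hxq : Tendsto (fun i => y i * tail F (x i)) l (𝓝 q))
    (hG : Tendsto (fun i => s i * (γh i - γ)) l (𝓝 g))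
    (hD : Tendsto (fun i => s i * (δh i - delta F γ C (Y i))) l (𝓝 d))
    (hZ : Tendsto (fun i => s i * (y i * tail F (Y i) - 1)) l (𝓝 z))
    (hτh : Tendsto τh l (𝓝 τ))
    (hm : Tendsto (fun i => s i * delta F γ C (Y i)) l (𝓝 m)) :
    Tendsto (fun i => s i *
        ((y i)⁻¹ * tail (epdCDF (γh i) (δh i) (τh i)) (x i / Y i) / tail F (x i) - 1)) l
      (𝓝 (-γ⁻¹ * g * Real.log q - γ⁻¹ * d * (1 - q ^ (-(γ * τ))) - z)) := by
  have hC := hF.pos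
  have hyY : Tendsto (fun i => y i * tail F (Y i)) l (𝓝 1) := by
    simpa using (tendsto_zero_of_mul_tendsto hs hZ).add_const 1
  have hγh : Tendsto γh l (𝓝 γ) := by
    simpa using (tendsto_zero_of_mul_tendsto hs hG).add_const γ
  have hr : Tendsto (fun i => x i / Y i) l (𝓝 (q ^ (-γ))) := by
    have h1 := hF.tendsto_div_rpow hγ hq0 hx hy hxq
    have h2 := hF.tendsto_div_rpow hγ one_pos hY hy hyY
    have h3 := h1.div h2 (by rw [div_one]; exact (Real.rpow_pos_of_pos hC γ).ne')
    have e : (C / q) ^ γ / (C / 1) ^ γ = q ^ (-γ) := by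
      rw [div_one, Real.div_rpow hC.le hq0.le, Real.rpow_neg hq0.le]
      have := (Real.rpow_pos_of_pos hC γ).ne'
      field_simp
    rw [e] at h3
    refine h3.congr' ?_
    filter_upwards [hy.eventually_gt_atTop 0] with i hi
    exact div_div_div_cancel_right₀ (Real.rpow_pos_of_pos hi γ).ne' _ _
  have hr0 : 0 < q ^ (-γ) := Real.rpow_pos_of_pos hq0 _
  have hQ : (q ^ (-γ)) ^ τ = q ^ (-(γ * τ)) := by
    rw [← Real.rpow_mul hq0.le, neg_mul]
  have hrτ : Tendsto (fun i => (x i / Y i) ^ τh i) l (𝓝 (q ^ (-(γ * τ)))) := by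
    rw [← hQ]
    exact hr.rpow hτh (Or.inl hr0.ne')
  set Q := q ^ (-(γ * τ)) with hQdef
  have hmx := hF.tendsto_mul_delta hmono hr0 hY hr hm
  rw [hQ] at hmx
  have hw : Tendsto (fun i => s i * (δh i * (1 - (x i / Y i) ^ τh i))) l
      (𝓝 ((d + m) * (1 - Q))) :=
    ((hD.add hm).mul (hrτ.const_sub 1)).congr fun i => by ring
  have L1 : Tendsto (fun i => s i * Real.log (y i * tail F (Y i))) l (𝓝 z) :=
    (tendsto_mul_log_one_add hs hZ).congr fun i => by rw [add_sub_cancel]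
  have hlogr : Tendsto (fun i => Real.log (x i / Y i)) l (𝓝 (-γ * Real.log q)) := by
    have := hr.log hr0.ne'
    rwa [Real.log_rpow hq0] at this
  have L2 : Tendsto (fun i => s i * ((γ⁻¹ - (γh i)⁻¹) * Real.log (x i / Y i))) l
      (𝓝 (g * (γ * γ)⁻¹ * (-γ * Real.log q))) := by
    have h1 := (hG.mul ((hγh.const_mul γ).inv₀ (mul_pos hγ hγ).ne')).mul hlogr
    refine h1.congr' ?_
    filter_upwards [hγh.eventually_ne hγ.ne'] with i hi
    field_simp
  have L3 : Tendsto
      (fun i => (γh i)⁻¹ * (s i * Real.log (1 + δh i * (1 - (x i / Y i) ^ τh i)))) l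
      (𝓝 (γ⁻¹ * ((d + m) * (1 - Q)))) :=
    (hγh.inv₀ hγ.ne').mul (tendsto_mul_log_one_add hs hw)
  have hmY' : Tendsto (fun i => s i * (γ⁻¹ * delta F γ C (Y i))) l (𝓝 (γ⁻¹ * m)) :=
    (hm.const_mul γ⁻¹).congr fun i => by ring
  have hmx' : Tendsto (fun i => s i * (γ⁻¹ * delta F γ C (x i))) l (𝓝 (γ⁻¹ * (m * Q))) :=
    (hmx.const_mul γ⁻¹).congr fun i => by ring
  have L4 := tendsto_mul_log_one_add hs hmY'
  have L5 := tendsto_mul_log_one_add hs hmx'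
  have one_add_pos : ∀ {v : ι → ℝ} {c : ℝ}, Tendsto (fun i => s i * v i) l (𝓝 c) →
      ∀ᶠ i in l, 0 < 1 + v i := fun {v c} hv => by
    have : Tendsto (fun i => 1 + v i) l (𝓝 1) := by
      simpa using (tendsto_zero_of_mul_tendsto hs hv).const_add 1
    exact this.eventually (lt_mem_nhds one_pos)
  have hr1 : 1 < q ^ (-γ) := Real.one_lt_rpow_of_pos_of_lt_one_of_neg hq0 hq1 (by linarith)
  have hpos : ∀ᶠ i in l, (0 < y i ∧ 0 < Y i ∧ 1 < x i / Y i) ∧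
      (0 < 1 + δh i * (1 - (x i / Y i) ^ τh i) ∧ 0 < 1 + γ⁻¹ * delta F γ C (Y i) ∧
        0 < 1 + γ⁻¹ * delta F γ C (x i)) ∧ 0 < tail F (Y i) ∧ 0 < tail F (x i) :=
    ((hy.eventually_gt_atTop 0).and ((hY.eventually_gt_atTop 0).and
      (hr.eventually (lt_mem_nhds hr1)))).and
      (((one_add_pos hw).and ((one_add_pos hmY').and (one_add_pos hmx'))).and
        ((hY.eventually hF.eventually_tail_pos).and (hx.eventually hF.eventually_tail_pos)))
  have hV : Tendsto (fun i => s i * Real.log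
        ((y i)⁻¹ * tail (epdCDF (γh i) (δh i) (τh i)) (x i / Y i) / tail F (x i))) l
      (𝓝 (-γ⁻¹ * g * Real.log q - γ⁻¹ * d * (1 - Q) - z)) := by
    have h := (((L1.neg.add L2).sub L3).add L4).sub L5
    -- The bias m cancels here.
    have e : -z + g * (γ * γ)⁻¹ * (-γ * Real.log q) - γ⁻¹ * ((d + m) * (1 - Q)) + γ⁻¹ * m
        - γ⁻¹ * (m * Q) = -γ⁻¹ * g * Real.log q - γ⁻¹ * d * (1 - Q) - z := by
      field_simp
      ring
    rw [e] at h
    refine h.congr' ?_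
    filter_upwards [hpos] with i ⟨⟨h1, h2, h3⟩, ⟨h4, h5, h6⟩, h7, h8⟩
    rw [log_estimator_ratio hγ hC h1 h2 h3 h4 h5 h6 h7 h8]
    ring
  -- Exponentiate: the delta method at 0 returns from log(p̂/p) to p̂/p - 1 with the same limit.
  have hE := tendsto_mul_sub_of_hasDerivAt (Real.hasDerivAt_exp 0) hs hV
  rw [Real.exp_zero, mul_one] at hE
  refine hE.congr' ?_
  filter_upwards [hpos] with i ⟨⟨h1, h2, h3⟩, ⟨h4, h5, h6⟩, h7, h8⟩
  rw [zero_add, Real.exp_log]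
  refine div_pos (mul_pos (inv_pos.2 h1) ?_) h8
  rw [tail_epdCDF h3]
  exact Real.rpow_pos_of_pos (mul_pos (by linarith) h4) _

end Expansion

/-! ### Limits of bounded sequences along ultrafilters -/

section Ultrafilter

variable {ι : Type*}

theorem exists_tendsto_of_abs_le {u : Ultrafilter ι} {f b : ι → ℝ} {B : ℝ}
    (hb : Tendsto b u (𝓝 B)) (h : ∀ᶠ i in (u : Filter ι), |f i| ≤ b i) :
    ∃ m, Tendsto f u (𝓝 m) := by
  have hK : ((u.map f : Ultrafilter ℝ) : Filter ℝ) ≤ 𝓟 (Set.Icc (-(B + 1)) (B + 1)) := by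
    rw [le_principal_iff]
    change ∀ᶠ i in (u : Filter ι), f i ∈ Set.Icc (-(B + 1)) (B + 1)
    filter_upwards [h, hb.eventually (gt_mem_nhds (lt_add_one B))] with i h1 h2
    exact abs_le.1 (h1.trans h2.le)
  obtain ⟨m, _, hm⟩ := isCompact_Icc.ultrafilter_le_nhds _ hK
  exact ⟨m, hm⟩

variable {μ : Measure ℝ} {γ τ C : ℝ}

/-- If `s * a(y)` converges, then `s * δ(Y)` stays bounded for thresholds `Y` at level `1/y`. -/
theorem InClass.exists_tendsto_mul_delta {u : Ultrafilter ι} (hF : InClass (cdf μ) γ τ C)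
    (hγ : 0 < γ) {s y Y : ι → ℝ} {lam : ℝ} (hs : Tendsto s u atTop) (hy : Tendsto y u atTop)
    (hY : Tendsto Y u atTop) (hyY : Tendsto (fun i => y i * tail (cdf μ) (Y i)) u (𝓝 1))
    (ha : Tendsto (fun i => s i * auxA (cdf μ) γ C (y i)) u (𝓝 lam)) :
    ∃ m, Tendsto (fun i => s i * delta (cdf μ) γ C (Y i)) u (𝓝 m) := by
  have hC := hF.pos
  set U := fun i => tailQuantile (cdf μ) (y i) with hU
  have hUtop : Tendsto U u atTop := hF.tendsto_tailQuantile.comp hy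
  have ha0 := tendsto_zero_of_mul_tendsto hs ha
  have hb := tendsto_mul_sub_of_hasDerivAt
    (Real.hasDerivAt_rpow_const (p := 1 / γ) (Or.inl one_ne_zero)) hs ha
  obtain ⟨m, hm⟩ : ∃ m, Tendsto (fun i => s i * delta (cdf μ) γ C (U i)) u (𝓝 m) := by
    refine exists_tendsto_of_abs_le (hb.abs.const_mul (2 * γ)) ?_
    filter_upwards [hy.eventually (hF.abs_delta_tailQuantile_le hγ),
      hs.eventually_gt_atTop 0] with i h1 h2
    rw [Real.one_rpow, abs_mul, abs_mul, abs_of_pos h2]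
    nlinarith
  have hr : Tendsto (fun i => Y i / U i) u (𝓝 1) := by
    have hCγ : C ^ γ ≠ 0 := (Real.rpow_pos_of_pos hC γ).ne'
    have h1 := hF.tendsto_div_rpow hγ one_pos hY hy hyY
    rw [div_one] at h1
    have h2 := (h1.div_const (C ^ γ)).div (ha0.const_add 1) (by norm_num)
    rw [div_self hCγ, add_zero, div_one] at h2
    refine h2.congr' ?_
    filter_upwards [hy.eventually_gt_atTop 0] with i hi
    simp only [hU, tailQuantile_eq (cdf μ) γ hC hi, Pi.div_apply]
    rw [div_div, div_div]
    ring_nf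
  exact ⟨_, hF.tendsto_mul_delta (monotone_cdf μ) one_pos hUtop hr hm⟩

end Ultrafilter

/-! ### Measurability, tightness and reduction to ultrafilters -/

section Probability

variable {Ω Ω' : Type*} [MeasurableSpace Ω] [MeasurableSpace Ω']

/-- The sorted entry at 0-based index j is at most c iff more than j coordinates are, so each
sublevel set is a finite union of boxes. -/
theorem measurable_apply_sort {n : ℕ} (j : Fin n) :
    Measurable (fun v : Fin n → ℝ => v (Tuple.sort v j)) := by
  refine measurable_of_Iic fun c => ?_
  have h : (fun v : Fin n → ℝ => v (Tuple.sort v j)) ⁻¹' Set.Iic c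
      = ⋃ t ∈ {t : Finset (Fin n) | (j : ℕ) < t.card}, {v | ∀ i ∈ t, v i ≤ c} := by
    ext v
    have h1 := Tuple.lt_card_le_iff_apply_le_of_monotone (j := j) (a := c) (Tuple.monotone_sort v)
    have h2 : (Finset.univ.filter fun i => (v ∘ Tuple.sort v) i ≤ c).card
        = (Finset.univ.filter fun i => v i ≤ c).card :=
      Finset.card_equiv (Tuple.sort v) (by simp)
    rw [h2] at h1
    simp only [Set.mem_preimage, Set.mem_Iic, Set.mem_iUnion, Set.mem_ofPred_eq, exists_prop]
    rw [show v (Tuple.sort v j) ≤ c ↔ _ from h1.symm]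
    constructor
    · exact fun h => ⟨_, h, by simp⟩
    · rintro ⟨t, ht, hv⟩
      exact ht.trans_le (Finset.card_le_card fun i hi => by simpa using hv i hi)
  rw [h]
  refine MeasurableSet.biUnion (Set.to_countable _) fun t _ => ?_
  simp only [Set.ofPred_forall]
  exact MeasurableSet.iInter fun i => MeasurableSet.iInter fun _ =>
    measurableSet_le (measurable_pi_apply i) measurable_const

theorem aemeasurable_orderStat {P : Measure Ω} {X : ℕ → Ω → ℝ} (hX : ∀ i, AEMeasurable (X i) P)
    (n j : ℕ) : AEMeasurable (orderStat X n j) P := by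
  by_cases h : 1 ≤ j ∧ j ≤ n
  · have e : orderStat X n j = fun ω => (fun v : Fin n → ℝ =>
        v (Tuple.sort v ⟨j - 1, by omega⟩)) (fun i : Fin n => X i ω) := by
      funext ω
      simp only [orderStat, dif_pos h]
    rw [e]
    exact (measurable_apply_sort _).comp_aemeasurable (aemeasurable_pi_lambda _ fun i => hX i)
  · have e : orderStat X n j = fun _ => 0 := by
      funext ω
      simp only [orderStat, dif_neg h]
    rw [e]
    exact aemeasurable_const

theorem measurable_tail_epdCDF :
    Measurable (fun v : ℝ × ℝ × ℝ × ℝ => tail (epdCDF v.1 v.2.1 v.2.2.1) v.2.2.2) := by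
  unfold tail epdCDF
  refine measurable_const.sub (Measurable.ite ?_ (by fun_prop) measurable_const)
  exact measurableSet_lt measurable_const (by fun_prop)

theorem aemeasurable_pHat {P : Measure Ω} {X : ℕ → Ω → ℝ} (hX : ∀ i, AEMeasurable (X i) P)
    (k : ℕ → ℕ) {γhat δhat τhat : ℕ → Ω → ℝ} (hγhat : ∀ n, AEMeasurable (γhat n) P)
    (hδhat : ∀ n, AEMeasurable (δhat n) P) (hτhat : ∀ n, AEMeasurable (τhat n) P) (x : ℕ → ℝ)
    (n : ℕ) : AEMeasurable (pHat X k γhat δhat τhat x n) P := by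
  have h := measurable_tail_epdCDF.comp_aemeasurable ((hγhat n).prodMk ((hδhat n).prodMk
    ((hτhat n).prodMk ((aemeasurable_orderStat hX n (n - k n)).const_div (x n)))))
  exact h.const_mul ((k n : ℝ) / n)

/-- A sequence converging in distribution is tight. -/
theorem exists_eventually_measure_norm_ge_lt {E : Type*} [NormedAddCommGroup E]
    [MeasurableSpace E] [BorelSpace E] {P : Measure Ω} [IsProbabilityMeasure P]
    {P' : Measure Ω'} [IsProbabilityMeasure P'] {S : ℕ → Ω → E} {S' : Ω' → E}
    (hS : TendstoInDistribution S atTop S' (fun _ => P) P') {e : ENNReal} (he : 0 < e) :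
    ∃ M : ℝ, ∀ᶠ n in atTop, P {ω | M ≤ ‖S n ω‖} < e := by
  have hcl : ∀ M : ℝ, IsClosed {a : E | M ≤ ‖a‖} := fun M =>
    isClosed_le continuous_const continuous_norm
  have hlim : Tendsto (fun m : ℕ => P'.map S' {a : E | (m : ℝ) ≤ ‖a‖}) atTop (𝓝 0) := by
    have : IsProbabilityMeasure (P'.map S') :=
      Measure.isProbabilityMeasure_map hS.aemeasurable_limit
    have h := tendsto_measure_iInter_atTop (μ := P'.map S')
      (s := fun m : ℕ => {a : E | (m : ℝ) ≤ ‖a‖})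
      (fun m => (hcl m).measurableSet.nullMeasurableSet)
      (fun a b hab c (hc : (b : ℝ) ≤ ‖c‖) => le_trans (Nat.cast_le.2 hab : (a : ℝ) ≤ b) hc) ⟨0, measure_ne_top _ _⟩
    have he : (⋂ m : ℕ, {a : E | (m : ℝ) ≤ ‖a‖}) = ∅ := by
      refine Set.eq_empty_of_forall_notMem fun a ha => ?_
      obtain ⟨m, hm⟩ := exists_nat_gt ‖a‖
      exact absurd (Set.mem_iInter.1 ha m) (not_le.2 hm)
    rwa [he, measure_empty] at h
  obtain ⟨m, hm⟩ := (hlim.eventually (gt_mem_nhds he)).exists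
  refine ⟨m, ?_⟩
  -- Portmanteau for the closed set of points of norm at least m.
  have hsup := ProbabilityMeasure.limsup_measure_closed_le_of_tendsto hS.tendsto (hcl m)
  have := eventually_lt_of_limsup_lt (hsup.trans_lt hm)
  filter_upwards [this] with n hn
  rwa [ProbabilityMeasure.coe_mk,
    Measure.map_apply_of_aemeasurable (hS.forall_aemeasurable n) (hcl m).measurableSet] at hn

/-- To show that `R n → 0` in probability when `S n` converges in distribution and `T n → c` in
probability, it suffices to argue along ultrafilters along which `S` and `T` converge. -/
theorem tendstoInMeasure_zero_of_ultrafilter {E : Type*} [NormedAddCommGroup E] [ProperSpace E]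
    [MeasurableSpace E] [BorelSpace E] {P : Measure Ω} [IsProbabilityMeasure P]
    {P' : Measure Ω'} [IsProbabilityMeasure P'] {S : ℕ → Ω → E} {S' : Ω' → E}
    (hS : TendstoInDistribution S atTop S' (fun _ => P) P') {T R : ℕ → Ω → ℝ} {c : ℝ}
    (hT : TendstoInMeasure P T atTop (fun _ => c))
    (h : ∀ (u : Ultrafilter (ℕ × Ω)) (a : E), Tendsto Prod.fst (u : Filter (ℕ × Ω)) atTop →
      Tendsto (fun z : ℕ × Ω => S z.1 z.2) u (𝓝 a) →
      Tendsto (fun z : ℕ × Ω => T z.1 z.2) u (𝓝 c) →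
      Tendsto (fun z : ℕ × Ω => R z.1 z.2) u (𝓝 0)) :
    TendstoInMeasure P R atTop 0 := by
  rw [tendstoInMeasure_iff_norm]
  intro ε hε
  rw [ENNReal.tendsto_nhds_zero]
  intro e he
  have he2 : 0 < e / 2 := ENNReal.half_pos he.ne'
  obtain ⟨M, hM⟩ := exists_eventually_measure_norm_ge_lt hS he2
  -- This filter encodes n large, T near c and S in a ball. Properness makes S converge along every
  -- finer ultrafilter; a basis set of the filter then bounds R uniformly in ω.
  have hR : Tendsto (fun z : ℕ × Ω => R z.1 z.2)
      (comap (fun z : ℕ × Ω => (z.1, T z.1 z.2)) (atTop ×ˢ 𝓝 c) ⊓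
        𝓟 {z : ℕ × Ω | ‖S z.1 z.2‖ ≤ M}) (𝓝 0) := by
    rw [tendsto_iff_ultrafilter]
    intro u hu
    rw [le_inf_iff, ← tendsto_iff_comap, le_principal_iff] at hu
    have hK : ((u.map (fun z : ℕ × Ω => S z.1 z.2) : Ultrafilter E) : Filter E)
        ≤ 𝓟 (Metric.closedBall 0 M) := by
      rw [le_principal_iff]
      change ∀ᶠ z in (u : Filter (ℕ × Ω)), S z.1 z.2 ∈ Metric.closedBall 0 M
      filter_upwards [hu.2] with z hz
      simpa using hz
    obtain ⟨a, _, ha⟩ := (isCompact_closedBall (0 : E) M).ultrafilter_le_nhds _ hK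
    have hu' : Tendsto (fun z : ℕ × Ω => (z.1, T z.1 z.2)) u (atTop ×ˢ 𝓝 c) := hu.1
    exact h u a ((tendsto_fst (f := (atTop : Filter ℕ)) (g := 𝓝 c)).comp hu') ha
      ((tendsto_snd (f := (atTop : Filter ℕ)) (g := 𝓝 c)).comp hu')
  have hmem := mem_inf_principal.1 (hR.eventually (Metric.ball_mem_nhds 0 hε))
  obtain ⟨⟨N, η⟩, ⟨-, hη⟩, hsub⟩ :=
    ((atTop_basis.prod Metric.nhds_basis_ball).comap _).mem_iff.1 hmem
  have hT' := (ENNReal.tendsto_nhds_zero.1 (tendstoInMeasure_iff_norm.1 hT η hη)) (e / 2) he2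
  filter_upwards [hM, hT', eventually_ge_atTop N] with n h1 h2 h3
  calc P {ω | ε ≤ ‖R n ω - (0 : ℕ → Ω → ℝ) n ω‖}
      ≤ P ({ω | M ≤ ‖S n ω‖} ∪ {ω | η ≤ ‖T n ω - c‖}) := by
        refine measure_mono fun ω hω => ?_
        by_contra hcon
        simp only [Set.mem_union, Set.mem_ofPred_eq, not_or, not_le] at hcon
        have := hsub (show ((n, ω) : ℕ × Ω) ∈ _ from
          ⟨h3, by simpa [dist_eq_norm] using hcon.2⟩) hcon.1.le
        simp only [Set.mem_ofPred_eq, dist_zero_right] at this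
        simp only [Set.mem_ofPred_eq, Pi.zero_apply, sub_zero] at hω
        linarith
    _ ≤ e / 2 + e / 2 := (measure_union_le _ _).trans (add_le_add h1.le h2)
    _ = e := ENNReal.add_halves e

end Probability

end ExtPareto

/-! ### The limit theorem -/

theorem theorem2
    {Ω Ω' : Type*} [MeasurableSpace Ω] [MeasurableSpace Ω']
    (P : Measure Ω) [IsProbabilityMeasure P] (P' : Measure Ω') [IsProbabilityMeasure P']
    -- the distribution function `F = cdf μ`, in the class with constants `γ`, `τ`
    (μ : Measure ℝ) [IsProbabilityMeasure μ]
    (γ τ C : ℝ) (hγ : 0 < γ) (hτ : τ < 0) (hF : ExtPareto.InClass (cdf μ) γ τ C)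
    -- the independent sample from `F`
    (X : ℕ → Ω → ℝ) (hX_law : ∀ i, HasLaw (X i) μ P) (hX_indep : iIndepFun X P)
    -- the intermediate sequence
    (k : ℕ → ℕ) (hk : ExtPareto.IsIntermediate k)
    (lam : ℝ)
    (hka : Tendsto (fun n : ℕ => √(k n : ℝ) * ExtPareto.auxA (cdf μ) γ C ((n : ℝ) / k n))
      atTop (𝓝 lam))
    -- the tail probabilities `p n = 1 - F (x n)`
    (x p : ℕ → ℝ) (hx : Tendsto x atTop atTop)
    (hp : ∀ n, p n = ExtPareto.tail (cdf μ) (x n))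
    (q : ℝ) (hq0 : 0 < q) (hq1 : q < 1)
    (hpq : Tendsto (fun n : ℕ => n * p n / k n) atTop (𝓝 q))
    -- the estimators
    (γhat δhat τhat : ℕ → Ω → ℝ) (hγhat : ∀ n, AEMeasurable (γhat n) P)
    (hδhat : ∀ n, AEMeasurable (δhat n) P) (hτhat : ∀ n, AEMeasurable (τhat n) P)
    (hτ_consistent : TendstoInMeasure P τhat atTop (fun _ => τ))
    (Γ Δ Z : Ω' → ℝ)
    (hjoint : TendstoInDistribution
      (fun (n : ℕ) (ω : Ω) =>
        (√(k n : ℝ) * (γhat n ω - γ),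
         √(k n : ℝ) *
          (δhat n ω - ExtPareto.delta (cdf μ) γ C (ExtPareto.orderStat X n (n - k n) ω)),
         ExtPareto.Zstat (cdf μ) X k n ω))
      atTop (fun ω' => (Γ ω', Δ ω', Z ω')) (fun _ => P) P') :
    TendstoInDistribution
      (fun (n : ℕ) (ω : Ω) =>
        √(k n : ℝ) * (ExtPareto.pHat X k γhat δhat τhat x n ω / p n - 1))
      atTop
      (fun ω' => -γ⁻¹ * Γ ω' * Real.log q - γ⁻¹ * Δ ω' * (1 - q ^ (-(γ * τ))) - Z ω')
      (fun _ => P) P' := by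
  have hX : ∀ i, AEMeasurable (X i) P := fun i => (hX_law i).aemeasurable
  have hs : Tendsto (fun n => √(k n : ℝ)) atTop atTop :=
    Real.tendsto_sqrt_atTop.comp (tendsto_natCast_atTop_atTop.comp hk.tendsto_atTop)
  have hkpos : ∀ᶠ n : ℕ in atTop, (0 : ℝ) < k n :=
    (tendsto_natCast_atTop_atTop.comp hk.tendsto_atTop).eventually_gt_atTop 0
  have hy : Tendsto (fun n : ℕ => (n : ℝ) / k n) atTop atTop := by
    have h1 : Tendsto (fun n : ℕ => (k n : ℝ) / n) atTop (𝓝[>] 0) := by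
      refine tendsto_nhdsWithin_iff.2 ⟨hk.tendsto_div, ?_⟩
      filter_upwards [hkpos, eventually_gt_atTop 0] with n h1 h2
      exact div_pos h1 (Nat.cast_pos.2 h2)
    exact h1.inv_tendsto_nhdsGT_zero.congr fun n => inv_div _ _
  have hxq : Tendsto (fun n : ℕ => (n : ℝ) / k n * ExtPareto.tail (cdf μ) (x n)) atTop (𝓝 q) :=
    hpq.congr fun n => by rw [hp]; ring
  set L : ℝ × ℝ × ℝ → ℝ := fun v =>
    -γ⁻¹ * v.1 * Real.log q - γ⁻¹ * v.2.1 * (1 - q ^ (-(γ * τ))) - v.2.2 with hL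
  have hLc : Continuous L := by
    simp only [hL]
    fun_prop
  -- Slutsky: only the difference from the linear image `L` of the joint statistics must vanish in
  -- probability.
  refine tendstoInDistribution_of_tendstoInMeasure_sub _ _ (hjoint.continuous_comp hLc) ?_
    fun n => (((ExtPareto.aemeasurable_pHat hX k hγhat hδhat hτhat x n).div_const
      (p n)).sub_const 1).const_mul _
  refine ExtPareto.tendstoInMeasure_zero_of_ultrafilter hjoint hτ_consistent ?_
  intro u a hu hS hT
  have hG := hS.fst_nhds
  have hD := hS.snd_nhds.fst_nhds
  have hZ : Tendsto (fun z : ℕ × Ω => √(k z.1 : ℝ) * ((z.1 : ℝ) / k z.1 *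
      ExtPareto.tail (cdf μ) (ExtPareto.orderStat X z.1 (z.1 - k z.1) z.2) - 1)) u
      (𝓝 a.2.2) :=
    hS.snd_nhds.snd_nhds.congr fun z => by
      simp only [ExtPareto.Zstat]
      ring
  have hsu := hs.comp hu
  have hyu := hy.comp hu
  have hyY : Tendsto (fun z : ℕ × Ω => (z.1 : ℝ) / k z.1 *
      ExtPareto.tail (cdf μ) (ExtPareto.orderStat X z.1 (z.1 - k z.1) z.2)) u (𝓝 1) := by
    simpa using (ExtPareto.tendsto_zero_of_mul_tendsto hsu hZ).add_const 1
  have hY : Tendsto (fun z : ℕ × Ω => ExtPareto.orderStat X z.1 (z.1 - k z.1) z.2) u atTop := by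
    refine hF.tendsto_atTop_of_tail (monotone_cdf μ) ?_
    refine (hyY.div_atTop hyu).congr' ?_
    filter_upwards [hyu.eventually_ne_atTop 0] with z hz
    exact mul_div_cancel_left₀ _ hz
  obtain ⟨m, hm⟩ := hF.exists_tendsto_mul_delta hγ hsu hyu hY hyY (hka.comp hu)
  have hE := hF.tendsto_relative_error hγ (monotone_cdf μ) hq0 hq1 hsu hyu (hx.comp hu) hY
    (hxq.comp hu) hG hD hZ hT hm
  have hdiff := hE.sub ((hLc.tendsto a).comp hS)
  rw [show -γ⁻¹ * a.1 * Real.log q - γ⁻¹ * a.2.1 * (1 - q ^ (-(γ * τ))) - a.2.2 - L a = 0 from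
    sub_self _] at hdiff
  refine hdiff.congr fun z => ?_
  simp only [ExtPareto.pHat, Function.comp, Pi.sub_apply, hp, inv_div]
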